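/- **Theorem (optimal HD schedulers are also optimal HR schedulers).** Let $\mathcal M=(L,Act,\mathbf R,\nu,B)$ be a (not necessarily uniform) continuous-time Markov decision process: $L$ and $Act$ are finite sets of locations and actions, $\mathbf R: L\times Act\times L\to\mathbb Q_{\ge 0}$ is a rate matrix, $\nu$ is an initial distribution on $L$, $B\subseteq L$ is a goal region, and in every location $l$ some action $a$ is enabled, i.e. has positive total exit rate $\mathbf R(l,a,L)=\sum_{l'\in L}\mathbf R(l,a,l')$. A time-abstract path is a finite sequence $l_0\xrightarrow{a_0}l_1\xrightarrow{a_1}\cdots\xrightarrow{a_{n-1}}l_n$. An HR (history-dependent randomised) scheduler maps every time-abstract path $\pi$ to a probability distribution on the actions enabled in the last location of $\pi$. An HD (history-dependent deterministic) scheduler maps every such $\pi$ to a single action enabled in its last location, and is regarded as the HR scheduler that chooses this action with probability $1$. A scheduler $\mathcal S$ induces the usual probability measure on timed paths: after the time-abstract history $\pi$ ending in $l$, the action $a$ is chosen with probability $\mathcal S(\pi)(a)$, the time spent in $l$ is exponentially distributed with rate $\mathbf R(l,a,L)$, and independently of it the next location is $l'$ with probability $\mathbf R(l,a,l')/\mathbf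 R(l,a,L)$. For $t\ge 0$ let $Pr_{\mathcal S}^{\mathcal M}(l,t)$ be the probability that a path starting in $l$ reaches $B$ within time $t$, and let $Pr_{\mathcal S}^{\mathcal M}(t)=\sum_{l\in L}\nu(l)\,Pr_{\mathcal S}^{\mathcal M}(l,t)$. A scheduler of a class is optimal for this class (and the time bound $t$) if it attains the supremum of $Pr^{\mathcal M}_{\mathcal S'}(t)$ over all schedulers $\mathcal S'$ of the class. Then, for every $t\ge 0$, every scheduler $\mathcal S$ that is optimal among the HD schedulers of $\mathcal M$ is also optimal among the HR schedulers of $\mathcal M$: $$Pr_{\mathcal S}^{\mathcal M}(t)=\sup_{\mathcal S'\in HD}Pr_{\mathcal S'}^{\mathcal M}(t)\quad\Longrightarrow\quad Pr_{\mathcal S}^{\mathcal M}(t)=\sup_{\mathcal S'\in HR}Pr_{\mathcal S'}^{\mathcal M}(t).$$ -/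

import Mathlib

open MeasureTheory ProbabilityTheory Finset
open scoped ENNReal NNReal

noncomputable section

/-- A continuous-time Markov decision process with locations `L` and actions `A`: a rate matrix,
an initial distribution and a goal region, such that in every location some action has a positive
total exit rate. -/
structure CTMDP (L A : Type*) [Fintype L] where
  rate : L → A → L → ℚ≥0
  init : PMF L
  goal : Set L
  exists_enabled : ∀ l, ∃ a, 0 < ∑ l', rate l a l'

namespace CTMDP

/-- Time-abstract paths `l₀ -a₀-> l₁ -a₁-> ⋯ -aₙ₋₁-> lₙ`: a path is a location, or a path followed
by an action and a location. -/
inductive AbsPath (L A : Type*) : Type _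
  | start (l : L) : AbsPath L A
  | step (π : AbsPath L A) (a : A) (l : L) : AbsPath L A

/-- The last location of a time-abstract path. -/
def AbsPath.last {L A : Type*} : AbsPath L A → L
  | .start l => l
  | .step _ _ l => l

/-- The time-abstract path that starts in `l₀` and then takes `n` given transitions, each of
them an action together with the location it leads to. -/
def AbsPath.ofSteps {L A : Type*} (l₀ : L) : (n : ℕ) → (Fin n → A × L) → AbsPath L A
  | 0, _ => .start l₀
  | n + 1, y => .step (ofSteps l₀ n fun i => y i.castSucc) (y (Fin.last n)).1 (y (Fin.last n)).2

section Basic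

variable {L A : Type*} [Fintype L] (M : CTMDP L A)

/-- The total exit rate of action `a` in location `l`. -/
def exitRate (l : L) (a : A) : ℚ≥0 := ∑ l', M.rate l a l'

/-- The actions that are enabled in `l`. -/
def Act (l : L) : Set A := {a | 0 < M.exitRate l a}

/-- The time-abstract transition probability. -/
def transProb (l : L) (a : A) (l' : L) : ℚ≥0 := M.rate l a l' / M.exitRate l a

/-- History-dependent randomised schedulers: they map every time-abstract path to a distribution
over the actions enabled in its last location. -/
def HR : Type _ := (π : AbsPath L A) → PMF (M.Act π.last)

/-- History-dependent deterministic schedulers: they map every time-abstract path to an action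
enabled in its last location. -/
def HD : Type _ := (π : AbsPath L A) → M.Act π.last

/-- A deterministic scheduler as a randomised one that chooses its decision with probability 1. -/
def HD.toHR {M : CTMDP L A} (S : M.HD) : M.HR := fun π => PMF.pure (S π)

end Basic

/-- The data of one transition: the action taken, the time spent in the location before the
transition happens, and the location that is entered. -/
abbrev Transition (L A : Type*) : Type _ := A × ℝ × L

section Measure

variable {L A : Type*} [Fintype L] [Fintype A] [MeasurableSpace L] [DiscreteMeasurableSpace L]
  [MeasurableSpace A] [DiscreteMeasurableSpace A] (M : CTMDP L A)

open Classical in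
/-- The law of the transition that follows the time-abstract history `π`: with `l` the last location
of `π`, the action `a` is drawn from `S π`, the sojourn time is exponentially distributed with
rate `exitRate l a`, and the next location `l'` is drawn with probability `transProb l a l'`. -/
def transitionLaw (S : M.HR) (π : AbsPath L A) : Measure (Transition L A) :=
  ∑ a : M.Act π.last, ∑ l' : L,
    (S π a * ((M.transProb π.last a l' : ℝ≥0) : ℝ≥0∞)) •
      (expMeasure (M.exitRate π.last a : ℝ)).map fun τ => ((a : A), τ, l')

instance (S : M.HR) (π : AbsPath L A) : IsProbabilityMeasure (M.transitionLaw S π) := by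
  constructor
  have key : ∀ a : M.Act π.last, ∑ l', ((M.transProb π.last a l' : ℝ≥0) : ℝ≥0∞) = 1 := by
    intro a
    rw [← ENNReal.ofNNReal_finsetSum, ← NNRat.cast_sum]
    have h : M.exitRate π.last a ≠ 0 := ne_of_gt a.2
    simp only [transProb, ← Finset.sum_div]
    rw [show ∑ l', M.rate π.last a l' = M.exitRate π.last a from rfl, div_self h]
    simp
  have hexp : ∀ a : M.Act π.last, ∀ l' : L, ((expMeasure (M.exitRate π.last a : ℝ)).map
      fun τ => ((a : A), τ, l')) Set.univ = 1 := by
    intro a l'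
    have hpos : (0 : ℝ) < (M.exitRate π.last a : ℝ) := by exact_mod_cast a.2
    have := isProbabilityMeasure_expMeasure hpos
    rw [Measure.map_apply (by fun_prop) MeasurableSet.univ]
    simp
  simp only [transitionLaw, Measure.coe_finsetSum, Measure.smul_apply, Finset.sum_apply,
    smul_eq_mul, hexp, mul_one, ← Finset.mul_sum, key]
  classical
  exact (tsum_fintype _).symm.trans (S π).tsum_coe

/-- The law of the `(n+2)`nd transition given the first `n+1` transitions, for a start in `l₀`. -/
def transitionKernel (S : M.HR) (l₀ : L) (n : ℕ) :
    Kernel ((i : Iic n) → Transition L A) (Transition L A) :=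
  (Kernel.ofFunOfCountable fun y : Fin (n + 1) → A × L =>
      M.transitionLaw S (AbsPath.ofSteps l₀ (n + 1) y)).comap
    (fun x i => ((x ⟨i, mem_Iic.2 (Nat.lt_succ_iff.1 i.2)⟩).1,
      (x ⟨i, mem_Iic.2 (Nat.lt_succ_iff.1 i.2)⟩).2.2))
    (by fun_prop)

instance (S : M.HR) (l₀ : L) (n : ℕ) : IsMarkovKernel (M.transitionKernel S l₀ n) := by
  constructor
  intro x
  rw [transitionKernel, Kernel.comap_apply]
  exact inferInstanceAs (IsProbabilityMeasure (M.transitionLaw S _))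

/-- The probability measure that the scheduler `S` induces on the infinite timed paths starting in
`l₀`, a timed path being given by its sequence of transitions. -/
def pathMeasure (S : M.HR) (l₀ : L) : Measure (ℕ → Transition L A) :=
  Kernel.trajMeasure (X := fun _ => Transition L A) (M.transitionLaw S (.start l₀))
    (M.transitionKernel S l₀)

end Measure

/-- The location that a timed path from `l₀` has reached after `n` transitions. -/
def locAfter {L A : Type*} (l₀ : L) (ω : ℕ → Transition L A) : ℕ → L
  | 0 => l₀
  | n + 1 => (ω n).2.2

/-- The time at which the `n`-th transition happens (`0` for `n = 0`), that is, the sum of the first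
`n` sojourn times. -/
def timeAfter {L A : Type*} (ω : ℕ → Transition L A) (n : ℕ) : ℝ :=
  ∑ i ∈ range n, (ω i).2.1

section Reach

variable {L A : Type*} [Fintype L] [Fintype A] [MeasurableSpace L] [DiscreteMeasurableSpace L]
  [MeasurableSpace A] [DiscreteMeasurableSpace A] (M : CTMDP L A)

/-- The timed paths from `l₀` that reach the goal region within time `t`. -/
def reachEvent (l₀ : L) (t : ℝ) : Set (ℕ → Transition L A) :=
  {ω | ∃ n, locAfter l₀ ω n ∈ M.goal ∧ timeAfter ω n ≤ t}

/-- The probability of reaching the goal region within time `t` when starting in `l`. -/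
def probFrom (S : M.HR) (l : L) (t : ℝ) : ℝ≥0∞ := M.pathMeasure S l (M.reachEvent l t)

/-- The time-bounded reachability probability under the scheduler `S`. -/
def prob (S : M.HR) (t : ℝ) : ℝ≥0∞ := ∑ l, M.init l * M.probFrom S l t

/-- `S` is an optimal HR scheduler for the time bound `t`: it attains the time-bounded
reachability, the supremum of the reachability probabilities over all HR schedulers. -/
def IsOptimalHR (S : M.HR) (t : ℝ) : Prop := M.prob S t = ⨆ S' : M.HR, M.prob S' t

/-- `S` is an optimal HD scheduler for the time bound `t`: it attains the supremum of the
reachability probabilities over all HD schedulers. -/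
def IsOptimalHD (S : M.HD) (t : ℝ) : Prop := M.prob S.toHR t = ⨆ S' : M.HD, M.prob S'.toHR t

end Reach

end CTMDP

end

/-! A scheduler sees only the time-abstract history, so it influences how likely such a history is,
but not the law of its duration. By `arrivalLaw_eq`, the law of the `n`-th transition time on a
given history `π` is `pathProb S π • durationLaw π`, where only the scalar depends on the scheduler.
Hence reaching the goal within time `t` and `N` transitions is a finite-horizon decision problem on
histories, with reward `durationLaw π (Set.Iic t)` when the goal is first entered. Randomising
averages the values of the enabled actions, so it never beats the best one
(`histValue_le_optValue`), and backward induction yields a deterministic maximiser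
(`exists_histValue_eq_optValue`). The unbounded probability is the supremum over `N` of the
step-bounded ones (`prob_eq_iSup`). The maximiser may vary with `N`, but each is bounded by the HD
supremum, which therefore bounds every HR scheduler. -/

noncomputable section

/-! ### Time-abstract histories of timed paths -/

namespace CTMDP

/-- The action and location components of the first `n` transitions. -/
def abstractSteps {L A : Type*} (n : ℕ) (ω : ℕ → Transition L A) : Fin n → A × L :=
  fun i => ((ω i).1, (ω i).2.2)

lemma last_ofSteps_abstractSteps {L A : Type*} (l : L) (ω : ℕ → Transition L A) (n : ℕ) :
    (AbsPath.ofSteps l n (abstractSteps n ω)).last = locAfter l ω n := by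
  cases n <;> rfl

/-- No location strictly before the end of the path belongs to `G`. -/
def AbsPath.Avoids {L A : Type*} (G : Set L) : AbsPath L A → Prop
  | .start _ => True
  | .step π _ _ => π.Avoids G ∧ π.last ∉ G

lemma avoids_ofSteps_abstractSteps {L A : Type*} (G : Set L) (l : L) (ω : ℕ → Transition L A)
    (n : ℕ) : (AbsPath.ofSteps l n (abstractSteps n ω)).Avoids G ↔
      ∀ k < n, locAfter l ω k ∉ G := by
  induction n with
  | zero => simp [AbsPath.ofSteps, AbsPath.Avoids]
  | succ n ih =>
    have h : AbsPath.ofSteps l (n + 1) (abstractSteps (n + 1) ω) =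
      .step (AbsPath.ofSteps l n (abstractSteps n ω)) (ω n).1 (ω n).2.2 := rfl
    rw [h, AbsPath.Avoids, ih, last_ofSteps_abstractSteps, Nat.forall_lt_succ_right]

/-- The number of transitions of a time-abstract path. -/
def AbsPath.length {L A : Type*} : AbsPath L A → ℕ
  | .start _ => 0
  | .step π _ _ => π.length + 1

/-! ### Probability and duration of a time-abstract path -/

section Weights

variable {L A : Type*} [Fintype L] (M : CTMDP L A)

open Classical in
/-- The probability that `S` chooses the action `a` after the history `π`. -/
def actionProb (S : M.HR) (π : AbsPath L A) (a : A) : ℝ≥0∞ :=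
  if h : a ∈ M.Act π.last then S π ⟨a, h⟩ else 0

/-- The probability of the transition to `l'` by the action `a` after the history `π`. -/
def stepProb (S : M.HR) (π : AbsPath L A) (a : A) (l' : L) : ℝ≥0∞ :=
  M.actionProb S π a * ((M.transProb π.last a l' : ℝ≥0) : ℝ≥0∞)

/-- The probability of a time-abstract path under `S`. -/
def pathProb (S : M.HR) : AbsPath L A → ℝ≥0∞
  | .start _ => 1
  | .step π a l' => pathProb S π * M.stepProb S π a l'

/-- The law of the total duration of a time-abstract path: a sum of independent exponentially
distributed sojourn times. -/
def durationLaw : AbsPath L A → Measure ℝ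
  | .start _ => Measure.dirac 0
  | .step π a _ => (durationLaw π).conv (expMeasure (M.exitRate π.last a : ℝ))

/-- All real `r` are covered because a path may contain disabled actions, whose exit rate is 0; the
convolutions in `durationLaw` must still be well behaved there. -/
instance (r : ℝ) : SFinite (expMeasure r) := by
  unfold expMeasure gammaMeasure; infer_instance

instance sfinite_durationLaw (π : AbsPath L A) : SFinite (M.durationLaw π) := by
  induction π with
  | start l => unfold durationLaw; infer_instance
  | step π a l ih => unfold durationLaw; infer_instance

lemma sum_act_actionProb [Fintype A] (S : M.HR) (π : AbsPath L A) [Fintype (M.Act π.last)]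
    (f : A → ℝ≥0∞) :
    ∑ a, M.actionProb S π a * f a = ∑ a : M.Act π.last, S π a * f a := by
  classical
  have h : ∀ a : M.Act π.last, S π a * f a = M.actionProb S π a * f a := fun a => by
    simp [actionProb]
  rw [sum_congr rfl fun a _ => h a]
  refine (Fintype.sum_of_injective Subtype.val Subtype.val_injective _ _ (fun a ha => ?_)
    fun _ => rfl).symm
  rw [actionProb, dif_neg fun h => ha ⟨⟨a, h⟩, rfl⟩, zero_mul]

end Weights

@[fun_prop]
lemma measurable_abstractSteps {L A : Type*} [MeasurableSpace L] [MeasurableSpace A] (n : ℕ) :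
    Measurable (abstractSteps n : (ℕ → Transition L A) → Fin n → A × L) := by
  unfold abstractSteps; fun_prop

@[fun_prop]
lemma measurable_timeAfter {L A : Type*} [MeasurableSpace L] [MeasurableSpace A] (n : ℕ) :
    Measurable fun ω : ℕ → Transition L A => timeAfter ω n := by
  unfold timeAfter; fun_prop

/-! ### Factorisation of the path measure over time-abstract histories -/

section Law

variable {L A : Type*} [Fintype L] [Fintype A] [MeasurableSpace L] [DiscreteMeasurableSpace L]
  [MeasurableSpace A] [DiscreteMeasurableSpace A] (M : CTMDP L A)

lemma transitionLaw_apply_prod (S : M.HR) (π : AbsPath L A) (a : A) (l' : L) {B : Set ℝ}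
    (hB : MeasurableSet B) :
    M.transitionLaw S π {x | x.1 = a ∧ x.2.2 = l' ∧ x.2.1 ∈ B} =
      M.stepProb S π a l' * expMeasure (M.exitRate π.last a : ℝ) B := by
  classical
  have hs : MeasurableSet {x : Transition L A | x.1 = a ∧ x.2.2 = l' ∧ x.2.1 ∈ B} := by
    refine (measurableSet_eq_fun (by fun_prop) (by fun_prop)).inter
      ((measurableSet_eq_fun (by fun_prop) (by fun_prop)).inter (hB.preimage (by fun_prop)))
  have h : ∀ (b : M.Act π.last) (m : L), ((expMeasure (M.exitRate π.last b : ℝ)).map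
      fun τ => ((b : A), τ, m)) {x : Transition L A | x.1 = a ∧ x.2.2 = l' ∧ x.2.1 ∈ B} =
      if m = l' then (if (b : A) = a then expMeasure (M.exitRate π.last a : ℝ) B else 0) else 0 := by
    intro b m
    rw [Measure.map_apply (by fun_prop) hs]
    by_cases h1 : (b : A) = a <;> by_cases h2 : m = l' <;> simp [h1, h2, Set.preimage]
  simp only [transitionLaw, Measure.coe_finsetSum, Measure.smul_apply, Finset.sum_apply,
    smul_eq_mul, h, mul_ite, mul_zero, Finset.sum_ite_eq', Finset.mem_univ, if_true]
  unfold stepProb actionProb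
  split_ifs with ha
  · rw [Finset.sum_eq_single (⟨a, ha⟩ : M.Act π.last)]
    · simp
    · intro b _ hb
      rw [if_neg fun h => hb (Subtype.ext h)]
    · simp
  · rw [zero_mul, zero_mul]
    refine Finset.sum_eq_zero fun b _ => if_neg ?_
    rintro rfl
    exact ha b.2

omit [DiscreteMeasurableSpace L] [DiscreteMeasurableSpace A] in
lemma ae_transitionLaw_nonneg (S : M.HR) (π : AbsPath L A) :
    ∀ᵐ x ∂M.transitionLaw S π, 0 ≤ x.2.1 := by
  classical
  have hs : MeasurableSet {x : Transition L A | ¬ 0 ≤ x.2.1} := by measurability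
  rw [ae_iff, transitionLaw]
  simp only [Measure.coe_finsetSum, Measure.smul_apply, Finset.sum_apply, smul_eq_mul]
  refine Finset.sum_eq_zero fun a _ => Finset.sum_eq_zero fun l' _ => ?_
  rw [Measure.map_apply (by fun_prop) hs, expMeasure, gammaMeasure, withDensity_apply _ (by measurability)]
  convert mul_zero _
  -- The exponential density has integral 0 over the negative half-line.
  have := lintegral_gammaPDF_of_nonpos (x := 0) (a := 1) (r := M.exitRate π.last a) le_rfl
  rw [← this]
  congr 2
  ext; simp

/-- The law of the `n`-th transition time on the event that the first `n` transitions are `y`. -/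
def arrivalLaw (S : M.HR) (l : L) (n : ℕ) (y : Fin n → A × L) : Measure ℝ :=
  ((M.pathMeasure S l).restrict (abstractSteps n ⁻¹' {y})).map fun ω => timeAfter ω n

instance (S : M.HR) (l : L) : IsProbabilityMeasure (M.pathMeasure S l) := by
  unfold pathMeasure; infer_instance

instance (S : M.HR) (l : L) (n : ℕ) (y : Fin n → A × L) :
    IsFiniteMeasure (M.arrivalLaw S l n y) := by
  unfold arrivalLaw; infer_instance

lemma map_pathMeasure_zero (S : M.HR) (l : L) :
    (M.pathMeasure S l).map (fun ω => ω 0) = M.transitionLaw S (.start l) := by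
  have h1 : (fun ω : ℕ → Transition L A => ω 0) =
      (fun x : (i : Iic 0) → Transition L A => x ⟨0, by simp⟩) ∘ Preorder.frestrictLe 0 := rfl
  rw [h1, ← Measure.map_map (by fun_prop) (by fun_prop), pathMeasure, Kernel.trajMeasure,
    Measure.map_comp _ _ (by fun_prop), Kernel.traj_map_frestrictLe, Kernel.partialTraj_self,
    Measure.id_comp, Measure.map_map (by fun_prop) (by fun_prop)]
  exact Measure.map_id

/-- Once the abstract history is fixed, the law of the next transition no longer depends on the
elapsed times. This independence is what makes the joint law a product. -/
lemma map_restrict_pathMeasure (S : M.HR) (l : L) (n : ℕ) (y : Fin n → A × L) :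
    ((M.pathMeasure S l).restrict (abstractSteps n ⁻¹' {y})).map (fun ω => (timeAfter ω n, ω n)) =
      (M.arrivalLaw S l n y).prod (M.transitionLaw S (AbsPath.ofSteps l n y)) := by
  cases n with
  | zero =>
    have h1 : (abstractSteps 0 ⁻¹' {y} : Set (ℕ → Transition L A)) = Set.univ := by
      ext ω; simp [eq_iff_true_of_subsingleton]
    have h2 : (fun ω : ℕ → Transition L A => timeAfter ω 0) = fun _ => 0 := by
      ext; simp [timeAfter]
    have h3 : (fun ω : ℕ → Transition L A => (timeAfter ω 0, ω 0)) = Prod.mk 0 ∘ fun ω => ω 0 := by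
      ext ω <;> simp [timeAfter]
    rw [arrivalLaw, h1, h2, h3, Measure.restrict_univ, Measure.map_const, measure_univ, one_smul,
      Measure.dirac_prod, ← Measure.map_map (by fun_prop) (by fun_prop), map_pathMeasure_zero]
    rfl
  -- The kernel with index `n` conditions on `n + 1` transitions, whence the separate case of an
  -- empty history and the use of `f`, `g` to read off arrival time and abstract steps.
  | succ n =>
    set f : ((i : Iic n) → Transition L A) → ℝ := fun x =>
      ∑ i : Fin (n + 1), (x ⟨i, mem_Iic.2 (Nat.lt_succ_iff.1 i.2)⟩).2.1 with hf
    set g : ((i : Iic n) → Transition L A) → Fin (n + 1) → A × L := fun x i =>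
      ((x ⟨i, mem_Iic.2 (Nat.lt_succ_iff.1 i.2)⟩).1,
        (x ⟨i, mem_Iic.2 (Nat.lt_succ_iff.1 i.2)⟩).2.2) with hg
    have hfm : Measurable f := by fun_prop
    have hgm : Measurable g := by fun_prop
    have hfω : ∀ ω : ℕ → Transition L A, f (Preorder.frestrictLe n ω) = timeAfter ω (n + 1) :=
      fun ω => Fin.sum_univ_eq_sum_range (fun i => (ω i).2.1) (n + 1)
    have hgω : ∀ ω : ℕ → Transition L A,
      g (Preorder.frestrictLe n ω) = abstractSteps (n + 1) ω := fun ω => rfl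
    ext s hs
    have hs' : MeasurableSet {p : ((i : Iic n) → Transition L A) × Transition L A |
        g p.1 = y ∧ (f p.1, p.2) ∈ s} :=
      ((measurableSet_singleton y).preimage (hgm.comp measurable_fst)).inter
        (hs.preimage (by fun_prop))
    have key := congrArg (fun μ => μ {p : ((i : Iic n) → Transition L A) × Transition L A |
        g p.1 = y ∧ (f p.1, p.2) ∈ s})
      (Kernel.map_frestrictLe_trajMeasure_compProd_eq_map_trajMeasure
        (X := fun _ => Transition L A) (μ₀ := M.transitionLaw S (.start l)) (κ := M.transitionKernel S l) (a := n))
    beta_reduce at key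
    have hm := measurable_measure_prodMk_left
      (ν := M.transitionLaw S (AbsPath.ofSteps l (n + 1) y)) hs
    have hy : MeasurableSet (abstractSteps (n + 1) ⁻¹' {y} : Set (ℕ → Transition L A)) :=
      (measurableSet_singleton y).preimage (measurable_abstractSteps _)
    rw [Measure.map_apply (by fun_prop) hs', Measure.compProd_apply hs',
      lintegral_map (Kernel.measurable_kernel_prodMk_left hs') (by fun_prop)] at key
    rw [Measure.map_apply (by fun_prop) hs, Measure.restrict_apply (hs.preimage (by fun_prop)),
      Measure.prod_apply hs, arrivalLaw, lintegral_map hm (by fun_prop),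
      ← lintegral_indicator hy]
    refine (congrArg (M.pathMeasure S l) ?_).trans (key.symm.trans (lintegral_congr fun ω => ?_))
    · ext ω
      simp only [Set.mem_inter_iff, Set.mem_preimage, Set.mem_singleton_iff, Set.mem_ofPred_eq,
        hfω, hgω]
      exact and_comm
    · have hk : M.transitionKernel S l n (Preorder.frestrictLe n ω) =
          M.transitionLaw S (AbsPath.ofSteps l (n + 1) (abstractSteps (n + 1) ω)) := rfl
      rw [hk]
      by_cases h : abstractSteps (n + 1) ω = y
      · rw [Set.indicator_of_mem (by exact h), h]
        congr 1
        ext z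
        simp [hfω, hgω, h]
      · rw [Set.indicator_of_notMem (by exact h)]
        simp [hgω, h]

/-- Each transition multiplies the weight by `stepProb` and, by independence, convolves the arrival
time with an exponential law. -/
lemma arrivalLaw_eq (S : M.HR) (l : L) (n : ℕ) (y : Fin n → A × L) :
    M.arrivalLaw S l n y =
      M.pathProb S (AbsPath.ofSteps l n y) • M.durationLaw (AbsPath.ofSteps l n y) := by
  induction n with
  | zero =>
    have h1 : (abstractSteps 0 ⁻¹' {y} : Set (ℕ → Transition L A)) = Set.univ := by
      ext ω; simp [eq_iff_true_of_subsingleton]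
    have h2 : (fun ω : ℕ → Transition L A => timeAfter ω 0) = fun _ => 0 := by
      ext; simp [timeAfter]
    rw [arrivalLaw, h1, h2, Measure.restrict_univ, Measure.map_const, measure_univ, one_smul]
    simp [AbsPath.ofSteps, pathProb, durationLaw]
  | succ n ih =>
    set z : Fin n → A × L := fun i => y i.castSucc with hz
    set a := (y (Fin.last n)).1
    set l' := (y (Fin.last n)).2
    set π := AbsPath.ofSteps l n z with hπ
    have hstep : AbsPath.ofSteps l (n + 1) y = .step π a l' := rfl
    ext B hB
    have hadd : MeasurableSet {p : ℝ × ℝ | p.1 + p.2 ∈ B} := hB.preimage (by fun_prop)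
    have hs : MeasurableSet {p : ℝ × Transition L A |
        p.2.1 = a ∧ p.2.2.2 = l' ∧ p.1 + p.2.2.1 ∈ B} :=
      (measurableSet_eq_fun (by fun_prop) (by fun_prop)).inter
        ((measurableSet_eq_fun (by fun_prop) (by fun_prop)).inter (hB.preimage (by fun_prop)))
    have key := congrArg (fun μ => μ {p : ℝ × Transition L A |
        p.2.1 = a ∧ p.2.2.2 = l' ∧ p.1 + p.2.2.1 ∈ B}) (M.map_restrict_pathMeasure S l n z)
    beta_reduce at key
    rw [Measure.map_apply (by fun_prop) hs, Measure.restrict_apply (hs.preimage (by fun_prop)),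
      Measure.prod_apply hs] at key
    have hset : (fun ω : ℕ → Transition L A => timeAfter ω (n + 1)) ⁻¹' B ∩
        abstractSteps (n + 1) ⁻¹' {y} = (fun ω => (timeAfter ω n, ω n)) ⁻¹' {p |
        p.2.1 = a ∧ p.2.2.2 = l' ∧ p.1 + p.2.2.1 ∈ B} ∩ abstractSteps n ⁻¹' {z} := by
      ext ω
      simp only [Set.mem_inter_iff, Set.mem_preimage, Set.mem_singleton_iff, Set.mem_ofPred_eq,
        funext_iff, Fin.forall_fin_succ', abstractSteps, timeAfter, sum_range_succ, Prod.ext_iff,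
        hz, Fin.val_castSucc, Fin.val_last]
      tauto
    rw [arrivalLaw, Measure.map_apply (by fun_prop) hB,
      Measure.restrict_apply (hB.preimage (by fun_prop)), hset, key, ih, hstep]
    have hpre : ∀ r : ℝ, M.transitionLaw S π (Prod.mk r ⁻¹' {p : ℝ × Transition L A |
        p.2.1 = a ∧ p.2.2.2 = l' ∧ p.1 + p.2.2.1 ∈ B}) =
        M.stepProb S π a l' * expMeasure (M.exitRate π.last a : ℝ) {τ | r + τ ∈ B} := fun r =>
      M.transitionLaw_apply_prod S π a l' (hB.preimage (measurable_const_add r))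
    simp only [← hπ, hpre]
    have hm : Measurable fun r : ℝ => expMeasure (M.exitRate π.last a : ℝ) {τ | r + τ ∈ B} :=
      measurable_measure_prodMk_left hadd
    rw [lintegral_smul_measure, lintegral_const_mul _ hm,
      pathProb, durationLaw, Measure.smul_apply, Measure.conv,
      Measure.map_apply (by fun_prop) hB, Measure.prod_apply (hB.preimage (by fun_prop)),
      smul_eq_mul, smul_eq_mul, mul_assoc]
    rfl

/-- There are countably many indices and abstract histories, and on each history the next sojourn
time follows `transitionLaw`. -/
lemma ae_pathMeasure_nonneg (S : M.HR) (l : L) :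
    ∀ᵐ ω ∂M.pathMeasure S l, ∀ n, 0 ≤ (ω n).2.1 := by
  rw [ae_all_iff]
  intro n
  have hs : MeasurableSet {p : ℝ × Transition L A | ¬ 0 ≤ p.2.2.1} :=
    (measurableSet_Ici.preimage (f := fun p : ℝ × Transition L A => p.2.2.1) (by fun_prop)).compl
  have hz : ∀ y, M.pathMeasure S l ({ω | ¬ 0 ≤ (ω n).2.1} ∩ abstractSteps n ⁻¹' {y}) = 0 := by
    intro y
    have key := congrArg (fun μ => μ {p : ℝ × Transition L A | ¬ 0 ≤ p.2.2.1})
      (M.map_restrict_pathMeasure S l n y)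
    beta_reduce at key
    rw [Measure.map_apply (by fun_prop) hs, Measure.restrict_apply (hs.preimage (by fun_prop)),
      Measure.prod_apply hs] at key
    refine key.trans ?_
    have h := M.ae_transitionLaw_nonneg S (AbsPath.ofSteps l n y)
    rw [ae_iff] at h
    exact (lintegral_congr fun r => h).trans lintegral_zero
  rw [ae_iff, ← nonpos_iff_eq_zero]
  calc _ ≤ M.pathMeasure S l (⋃ y, {ω | ¬ 0 ≤ (ω n).2.1} ∩ abstractSteps n ⁻¹' {y}) :=
        measure_mono fun ω hω => Set.mem_iUnion.2 ⟨abstractSteps n ω, hω, rfl⟩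
    _ ≤ 0 := by rw [measure_iUnion_null_iff.2 hz]

end Law

/-! ### Step-bounded values and backward induction -/

section Values

variable {L A : Type*} [Fintype L] [Fintype A] (M : CTMDP L A) (t : ℝ)

open Classical in
/-- The probability, given that `S` has produced the time-abstract history `π`, of reaching the
goal region within time `t` after at most `n` further transitions. -/
def histValue (S : M.HR) : ℕ → AbsPath L A → ℝ≥0∞
  | 0, π => if π.last ∈ M.goal then M.durationLaw π (Set.Iic t) else 0
  | n + 1, π => if π.last ∈ M.goal then M.durationLaw π (Set.Iic t) else
      ∑ a, ∑ l', M.stepProb S π a l' * histValue S n (.step π a l')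

open Classical in
/-- The largest `histValue` that a scheduler can obtain. -/
def optValue : ℕ → AbsPath L A → ℝ≥0∞
  | 0, π => if π.last ∈ M.goal then M.durationLaw π (Set.Iic t) else 0
  | n + 1, π => if π.last ∈ M.goal then M.durationLaw π (Set.Iic t) else
      ⨆ a : M.Act π.last, ∑ l', ((M.transProb π.last a l' : ℝ≥0) : ℝ≥0∞) *
        optValue n (.step π a l')

open Classical in
lemma sum_stepProb_mul (S : M.HR) (π : AbsPath L A) (f : A → L → ℝ≥0∞) :
    ∑ a, ∑ l', M.stepProb S π a l' * f a l' = ∑ a : M.Act π.last,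
      S π a * ∑ l', ((M.transProb π.last a l' : ℝ≥0) : ℝ≥0∞) * f a l' := by
  rw [← M.sum_act_actionProb S π fun a => ∑ l', ((M.transProb π.last a l' : ℝ≥0) : ℝ≥0∞) * f a l']
  simp only [stepProb, mul_sum, mul_assoc]

/-- An average over actions is at most the best of them. -/
lemma histValue_le_optValue (S : M.HR) (n : ℕ) (π : AbsPath L A) :
    M.histValue t S n π ≤ M.optValue t n π := by
  classical
  induction n generalizing π with
  | zero => exact le_rfl
  | succ n ih =>
    rw [histValue, optValue]
    split_ifs
    · exact le_rfl
    · rw [sum_stepProb_mul]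
      calc _ ≤ ∑ a : M.Act π.last, S π a * ⨆ a : M.Act π.last,
              ∑ l', ((M.transProb π.last a l' : ℝ≥0) : ℝ≥0∞) * M.optValue t n (.step π a l') := by
            refine sum_le_sum fun a _ => mul_le_mul_right ((sum_le_sum fun l' _ =>
              mul_le_mul_right (ih _) _).trans ?_) _
            exact le_iSup (fun a : M.Act π.last => ∑ l', ((M.transProb π.last a l' : ℝ≥0) : ℝ≥0∞) *
              M.optValue t n (.step π a l')) a
        _ = _ := by
            rw [← sum_mul, ← tsum_fintype (L := .unconditional _), (S π).tsum_coe, one_mul]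

/-- Some deterministic scheduler attains the optimal values for the step bound `N`. -/
lemma exists_histValue_eq_optValue (N : ℕ) : ∃ D : M.HD, ∀ (n : ℕ) (π : AbsPath L A),
    n + π.length = N → M.histValue t D.toHR n π = M.optValue t n π := by
  classical
  have hne : ∀ l, Nonempty (M.Act l) := fun l => by
    obtain ⟨a, ha⟩ := M.exists_enabled l
    exact ⟨a, ha⟩
  -- The length of a history determines how many steps remain, so one scheduler can serve all
  -- stages. Choices at histories of length at least `N` play no role.
  have hmax : ∀ π : AbsPath L A, ∃ a : M.Act π.last, ∀ b : M.Act π.last,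
      ∑ l', ((M.transProb π.last b l' : ℝ≥0) : ℝ≥0∞) *
        M.optValue t (N - π.length - 1) (.step π b l') ≤
      ∑ l', ((M.transProb π.last a l' : ℝ≥0) : ℝ≥0∞) *
        M.optValue t (N - π.length - 1) (.step π a l') := fun π => Finite.exists_max _
  choose D hD using hmax
  refine ⟨D, fun n => ?_⟩
  induction n with
  | zero => exact fun _ _ => rfl
  | succ n ih =>
    intro π hπ
    rw [histValue, optValue]
    split_ifs
    · rfl
    have hn : N - π.length - 1 = n := by omega
    have ih' : ∀ (a : A) (l' : L), M.histValue t (HD.toHR D) n (.step π a l') =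
        M.optValue t n (.step π a l') := fun a l' => ih _ (by rw [AbsPath.length]; omega)
    have h := hD π
    rw [hn] at h
    simp only [ih']
    rw [sum_stepProb_mul M _ π fun a l' => M.optValue t n (.step π a l'),
      sum_eq_single (D π)]
    · simp only [HD.toHR, PMF.pure_apply, if_true, one_mul]
      exact le_antisymm (le_iSup (fun a : M.Act π.last =>
        ∑ l', ((M.transProb π.last a l' : ℝ≥0) : ℝ≥0∞) *
          M.optValue t n (.step π a l')) (D π)) (iSup_le h)
    · intro b _ hb
      simp [HD.toHR, hb]
    · simp

open Classical in
/-- The probability that the goal region is first entered by the `n`-th transition, and within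
time `t`. -/
def firstHitValue (S : M.HR) (l : L) (n : ℕ) : ℝ≥0∞ :=
  ∑ y : Fin n → A × L, if (AbsPath.ofSteps l n y).Avoids M.goal ∧
    (AbsPath.ofSteps l n y).last ∈ M.goal then M.pathProb S (AbsPath.ofSteps l n y) *
      M.durationLaw (AbsPath.ofSteps l n y) (Set.Iic t) else 0

open Classical in
/-- The expected value of `histValue` with `m` further transitions after `n` transitions, on the
event that the goal region is not entered before. -/
def expectedHistValue (S : M.HR) (l : L) (n m : ℕ) : ℝ≥0∞ :=
  ∑ y : Fin n → A × L, if (AbsPath.ofSteps l n y).Avoids M.goal then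
    M.pathProb S (AbsPath.ofSteps l n y) * M.histValue t S m (AbsPath.ofSteps l n y) else 0

lemma expectedHistValue_zero_right (S : M.HR) (l : L) (n : ℕ) :
    M.expectedHistValue t S l n 0 = M.firstHitValue t S l n := by
  refine sum_congr rfl fun y _ => ?_
  rw [histValue]
  split_ifs <;> simp_all

/-- A history that has avoided the goal so far either ends in it, contributing a first hit, or is
extended by one transition. -/
lemma expectedHistValue_succ_right (S : M.HR) (l : L) (n m : ℕ) :
    M.expectedHistValue t S l n (m + 1) =
      M.firstHitValue t S l n + M.expectedHistValue t S l (n + 1) m := by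
  classical
  have h : M.expectedHistValue t S l (n + 1) m = ∑ y : Fin n → A × L, ∑ a, ∑ l',
      if (AbsPath.ofSteps l n y).Avoids M.goal ∧ (AbsPath.ofSteps l n y).last ∉ M.goal then
        M.pathProb S (AbsPath.ofSteps l n y) * (M.stepProb S (AbsPath.ofSteps l n y) a l' *
          M.histValue t S m (.step (AbsPath.ofSteps l n y) a l')) else 0 := by
    rw [expectedHistValue, ← (Fin.snocEquiv fun _ => A × L).sum_comp, Fintype.sum_prod_type,
      sum_comm]
    refine sum_congr rfl fun y _ => ?_
    rw [Fintype.sum_prod_type]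
    refine sum_congr rfl fun a _ => sum_congr rfl fun l' _ => ?_
    have hs : AbsPath.ofSteps l (n + 1) (Fin.snocEquiv (fun _ => A × L) ((a, l'), y)) =
        .step (AbsPath.ofSteps l n y) a l' := by
      simp [AbsPath.ofSteps, Fin.snocEquiv]
    rw [hs, AbsPath.Avoids, pathProb, mul_assoc]
    congr
  rw [h, expectedHistValue, firstHitValue, ← sum_add_distrib]
  refine sum_congr rfl fun y _ => ?_
  rw [histValue]
  by_cases h1 : (AbsPath.ofSteps l n y).Avoids M.goal <;>
    by_cases h2 : (AbsPath.ofSteps l n y).last ∈ M.goal <;> simp [h1, h2, mul_sum]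

lemma expectedHistValue_eq_sum (S : M.HR) (l : L) (n m : ℕ) :
    M.expectedHistValue t S l n m = ∑ k ∈ range (m + 1), M.firstHitValue t S l (n + k) := by
  induction m generalizing n with
  | zero => simp [expectedHistValue_zero_right]
  | succ m ih =>
    rw [expectedHistValue_succ_right, ih, sum_range_succ' _ (m + 1), add_comm]
    simp [add_assoc, add_comm 1]

lemma sum_firstHitValue (S : M.HR) (l : L) (N : ℕ) :
    ∑ k ∈ range (N + 1), M.firstHitValue t S l k = M.histValue t S N (.start l) := by
  have h := M.expectedHistValue_eq_sum t S l 0 N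
  simp only [zero_add] at h
  rw [← h]
  simp [expectedHistValue, AbsPath.ofSteps, AbsPath.Avoids, pathProb]

end Values

/-! ### Reachability probabilities as limits of step-bounded values -/

section Reach

variable {L A : Type*} [Fintype L] [Fintype A] [MeasurableSpace L] [DiscreteMeasurableSpace L]
  [MeasurableSpace A] [DiscreteMeasurableSpace A] (M : CTMDP L A) (t : ℝ)

/-- The timed paths that first enter the goal region by the `n`-th transition, within time `t`. -/
def firstHitEvent (l : L) (n : ℕ) : Set (ℕ → Transition L A) :=
  {ω | ((AbsPath.ofSteps l n (abstractSteps n ω)).Avoids M.goal ∧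
    (AbsPath.ofSteps l n (abstractSteps n ω)).last ∈ M.goal) ∧ timeAfter ω n ≤ t}

lemma measurableSet_firstHitEvent (l : L) (n : ℕ) : MeasurableSet (M.firstHitEvent t l n) := by
  have h : MeasurableSet {y : Fin n → A × L | (AbsPath.ofSteps l n y).Avoids M.goal ∧
    (AbsPath.ofSteps l n y).last ∈ M.goal} := (Set.toFinite _).measurableSet
  exact (h.preimage (measurable_abstractSteps n)).inter
    (measurableSet_Iic.preimage (measurable_timeAfter n))

lemma pathMeasure_firstHitEvent (S : M.HR) (l : L) (n : ℕ) :
    M.pathMeasure S l (M.firstHitEvent t l n) = M.firstHitValue t S l n := by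
  classical
  have h := sum_measure_preimage_singleton (μ := (M.pathMeasure S l).restrict
    (M.firstHitEvent t l n)) (f := abstractSteps n) univ
    fun y _ => (measurableSet_singleton y).preimage (measurable_abstractSteps n)
  rw [coe_univ, Set.preimage_univ, Measure.restrict_apply_univ] at h
  rw [← h, firstHitValue]
  refine sum_congr rfl fun y _ => ?_
  have hy : MeasurableSet (abstractSteps n ⁻¹' {y} : Set (ℕ → Transition L A)) :=
    (measurableSet_singleton y).preimage (measurable_abstractSteps n)
  rw [Measure.restrict_apply hy]
  split_ifs with hg
  · rw [← smul_eq_mul, ← Measure.smul_apply, ← arrivalLaw_eq, arrivalLaw,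
      Measure.map_apply (by fun_prop) measurableSet_Iic, Measure.restrict_apply' hy, Set.inter_comm]
    congr 1
    ext ω
    simp only [firstHitEvent, Set.mem_inter_iff, Set.mem_preimage, Set.mem_singleton_iff,
      Set.mem_ofPred_eq, Set.mem_Iic]
    refine and_congr_left fun h => ?_
    rw [h, and_iff_right hg]
  · convert measure_empty (μ := M.pathMeasure S l)
    ext ω
    simp only [firstHitEvent, Set.mem_inter_iff, Set.mem_preimage, Set.mem_singleton_iff,
      Set.mem_ofPred_eq, Set.mem_empty_iff_false, iff_false]
    rintro ⟨rfl, h, -⟩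
    exact hg h

/-- Sojourn times are almost surely nonnegative, so a visit to the goal by time `t` forces the first
visit to be by time `t`. -/
lemma reachEvent_ae_eq (S : M.HR) (l : L) :
    M.reachEvent l t =ᵐ[M.pathMeasure S l] ⋃ n, M.firstHitEvent t l n := by
  classical
  filter_upwards [M.ae_pathMeasure_nonneg S l] with ω hω
  refine propext ?_
  change ω ∈ M.reachEvent l t ↔ ω ∈ ⋃ n, M.firstHitEvent t l n
  simp only [reachEvent, firstHitEvent, Set.mem_iUnion, Set.mem_ofPred_eq,
    avoids_ofSteps_abstractSteps, last_ofSteps_abstractSteps]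
  constructor
  · rintro ⟨n, hn, hnt⟩
    have hex : ∃ n, locAfter l ω n ∈ M.goal := ⟨n, hn⟩
    refine ⟨Nat.find hex, ⟨fun k hk => Nat.find_min hex hk, Nat.find_spec hex⟩, ?_⟩
    exact (sum_le_sum_of_subset_of_nonneg (range_subset_range.2 (Nat.find_min' hex hn))
      fun i _ _ => hω i).trans hnt
  · rintro ⟨n, ⟨-, hn⟩, hnt⟩
    exact ⟨n, hn, hnt⟩

lemma probFrom_eq_tsum (S : M.HR) (l : L) :
    M.probFrom S l t = ∑' n, M.firstHitValue t S l n := by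
  rw [probFrom, measure_congr (M.reachEvent_ae_eq t S l), measure_iUnion]
  · simp only [pathMeasure_firstHitEvent]
  · refine (pairwise_disjoint_on _).2 fun m n hmn => Set.disjoint_left.2 fun ω hm hn => ?_
    simp only [firstHitEvent, Set.mem_ofPred_eq, avoids_ofSteps_abstractSteps,
      last_ofSteps_abstractSteps] at hm hn
    exact hn.1.1 m hmn hm.1.2
  · exact M.measurableSet_firstHitEvent t l

lemma prob_eq_iSup (S : M.HR) :
    M.prob S t = ⨆ N, ∑ l, M.init l * M.histValue t S N (.start l) := by
  have h : ∀ l, M.init l * M.probFrom S l t =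
      ⨆ N, M.init l * M.histValue t S N (.start l) := fun l => by
    rw [probFrom_eq_tsum, ENNReal.tsum_eq_iSup_nat' (Filter.tendsto_add_atTop_nat 1),
      ENNReal.mul_iSup]
    simp only [sum_firstHitValue]
  rw [prob, sum_congr rfl fun l _ => h l, ENNReal.finsetSum_iSup_of_monotone]
  refine fun l m n hmn => mul_le_mul_right ?_ _
  rw [← sum_firstHitValue, ← sum_firstHitValue]
  exact sum_le_sum_of_subset (range_subset_range.2 (by omega))

lemma prob_le_iSup_prob_toHR (S : M.HR) : M.prob S t ≤ ⨆ D : M.HD, M.prob D.toHR t := by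
  rw [prob_eq_iSup]
  refine iSup_le fun N => ?_
  obtain ⟨D, hD⟩ := M.exists_histValue_eq_optValue t N
  -- `D` is built for horizon `N` only; its full reachability probability is at least its `N`-step
  -- value.
  refine le_trans ?_ (le_iSup _ D)
  rw [prob_eq_iSup]
  refine le_iSup_of_le N (sum_le_sum fun l _ => mul_le_mul_right ?_ _)
  rw [hD N (.start l) rfl]
  exact M.histValue_le_optValue t S N _

end Reach

end CTMDP

end

theorem mainTheorem4 {L A : Type*} [Fintype L] [Fintype A]
    [MeasurableSpace L] [DiscreteMeasurableSpace L]
    [MeasurableSpace A] [DiscreteMeasurableSpace A]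
    (M : CTMDP L A) (t : ℝ) (ht : 0 ≤ t) (S : M.HD) (hS : M.IsOptimalHD S t) :
    M.IsOptimalHR S.toHR t := by
  refine le_antisymm (le_iSup (fun S' : M.HR => M.prob S' t) S.toHR) (iSup_le fun S' => ?_)
  rw [hS]
  exact M.prob_le_iSup_prob_toHR t S'
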